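/- Let $\nu$ be a finite nonzero measure on a measurable space $\mathcal X$, let $t:\mathcal X\to\mathbb R^n$ be measurable with $\|t(x)\|_2\le R_2$ for all $x$, where $R_2>0$, and let $p_\theta(x)=\exp(\theta\cdot t(x)-A(\theta))$, $A(\theta)=\log\int e^{\theta\cdot t}\,d\nu$, be the exponential family with densities with respect to $\nu$. For data $z_1,\dots,z_D\in\mathcal X$ ($D\ge1$) and $\lambda\ge 0$ put $$f(\theta)=-\frac1D\sum_{i=1}^D\log p_\theta(z_i)+\frac\lambda2\|\theta\|_2^2,\qquad \bar t=\frac1D\sum_{i=1}^D t(z_i).$$ Let $\Theta\subseteq\mathbb R^n$ be closed and convex, let $\theta^*\in\arg\min_{\theta\in\Theta}f(\theta)$, let $\theta_0\in\Theta$, and let $\Pi_\Theta$ be the Euclidean projection onto $\Theta$. For each $\theta$ let $\mathbb M_\theta$ be a Markov kernel on $\mathcal X$ (measurable jointly in $\theta$ and the state) such that, for constants $C,\alpha$, $$\|\mathbb M_\theta^v q-p_\theta\|_{TV}\le C\alpha^v\quad\text{for all }\theta\in\Theta,\text{ all probability distributions }q\text{ and all }v\ge 0,$$ where $\|p-q\|_{TV}=\sup_B|p(B)-q(B)|$.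 Let $r$ be a probability distribution on $\mathcal X$, let $v\ge0$, $K\ge1$, $M$ be integers, and let $0<\delta<1$ with $M\ge 3K/\log(1/\delta)$. Then $f$ is differentiable and its gradient is $(4R_2^2+\lambda)$-Lipschitz. Moreover, let $L>0$ be any Lipschitz constant of the gradient of $f$ (for instance $L=4R_2^2+\lambda$), and for $k=1,\dots,K$, given the past, draw $x_1^{k-1},\dots,x_M^{k-1}$ independently from $q_{k-1}=\mathbb M_{\theta_{k-1}}^v r$ and set $$\theta_k=\Pi_\Theta\Big[\theta_{k-1}-\frac1L\Big(\frac1M\sum_{i=1}^M t(x_i^{k-1})-\bar t+\lambda\theta_{k-1}\Big)\Big].$$ Then, with probability at least $1-\delta$, $$f\Big(\frac1K\sum_{k=1}^K\theta_k\Big)-f(\theta^*)\le\frac{8R_2^2}{KL}\Big(\frac{L\|\theta_0-\theta^*\|_2}{4R_2}+\log\frac1\delta+\frac K{\sqrt M}+KC\alpha^v\Big)^2 .$$ -/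

import Mathlib

open MeasureTheory ProbabilityTheory

noncomputable section

namespace MCMCLearning

/-- Parameter space `ℝⁿ` with the Euclidean norm. -/
abbrev Param (n : ℕ) := EuclideanSpace ℝ (Fin n)

variable {n : ℕ} {X : Type*} [MeasurableSpace X]

/-- The log-partition function `A(θ) = log ∫ exp(θ · t(x)) dν(x)`, for the reference measure `ν`
(counting measure in the discrete case, Lebesgue measure for densities). -/
def logPartition (ν : Measure X) (t : X → Param n) (θ : Param n) : ℝ :=
  Real.log (∫ x, Real.exp (inner ℝ θ (t x)) ∂ν)

/-- The density `p_θ(x) = exp(θ · t(x) - A(θ))` with respect to `ν`. -/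
def density (ν : Measure X) (t : X → Param n) (θ : Param n) (x : X) : ℝ :=
  Real.exp (inner ℝ θ (t x) - logPartition ν t θ)

/-- The distribution with density `p_θ` with respect to `ν`. -/
def expFamily (ν : Measure X) (t : X → Param n) (θ : Param n) : Measure X :=
  ν.withDensity fun x => ENNReal.ofReal (density ν t θ x)

/-- The ridge-regularized negative log-likelihood of the data `z`. -/
def negLogLik (ν : Measure X) (t : X → Param n) (lam : ℝ) {D : ℕ} (z : Fin D → X)
    (θ : Param n) : ℝ :=
  -(1 / (D : ℝ)) * ∑ i, Real.log (density ν t θ (z i)) + lam / 2 * ‖θ‖ ^ 2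

/-- The empirical mean `t̄` of the sufficient statistics. -/
def empMean (t : X → Param n) {D : ℕ} (z : Fin D → X) : Param n :=
  (1 / (D : ℝ)) • ∑ i, t (z i)

/-- Total-variation distance `sup_A |p(A) - q(A)|` over measurable `A`. -/
def tvDist (p q : Measure X) : ℝ :=
  ⨆ A : {A : Set X // MeasurableSet A}, |p.real A - q.real A|

/-- The distribution after `v` steps of the Markov chain with kernel `T`, started from `q`. -/
def chainLaw (T : Kernel X X) (v : ℕ) (q : Measure X) : Measure X :=
  (fun p : Measure X => p.bind T)^[v] q

/-- Geometric mixing, uniformly over `θ ∈ Θ` and over all starting distributions. -/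
def FastMixing (ν : Measure X) (t : X → Param n) (T : Param n → Kernel X X)
    (Θ : Set (Param n)) (C α : ℝ) : Prop :=
  ∀ θ ∈ Θ, ∀ q : Measure X, IsProbabilityMeasure q → ∀ v : ℕ,
    tvDist (chainLaw (T θ) v q) (expFamily ν t θ) ≤ C * α ^ v

/-- Euclidean projection: a point of `Θ` nearest to `φ` (it exists and is unique whenever `Θ` is
nonempty, closed and convex). -/
def proj (Θ : Set (Param n)) (φ : Param n) : Param n :=
  Classical.epsilon fun θ => θ ∈ Θ ∧ ∀ θ' ∈ Θ, ‖θ - φ‖ ≤ ‖θ' - φ‖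

/-- `f` is differentiable and its gradient is `L`-Lipschitz in the Euclidean norm. -/
def HasLipschitzGradient (f : Param n → ℝ) (L : ℝ) : Prop :=
  Differentiable ℝ f ∧ ∀ θ φ, ‖gradient f θ - gradient f φ‖ ≤ L * ‖θ - φ‖

/-- One projected step of size `1 / L` from `θ`, with the gradient estimated from a batch `x` of
`M` samples as `(1/M) ∑ᵢ t(xᵢ) - t̄ + λ θ`. -/
def pgdStep (t : X → Param n) (tbar : Param n) (lam L : ℝ) (Θ : Set (Param n)) {M : ℕ}
    (θ : Param n) (x : Fin M → X) : Param n :=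
  proj Θ (θ - (1 / L) • ((1 / (M : ℝ)) • ∑ i, t (x i) - tbar + lam • θ))

/-- The iterates `θ₀, θ₁, …, θ_K` produced from the batches `h 0, …, h (K - 1)`: `θ_{k+1}` is
computed from `θ_k` and the batch `h k` (the sequence is constant after `K`). -/
def iter {K M : ℕ} (step : Param n → (Fin M → X) → Param n) (θ₀ : Param n)
    (h : Fin K → Fin M → X) : ℕ → Param n
  | 0 => θ₀
  | k + 1 => if hk : k < K then step (iter step θ₀ h k) (h ⟨k, hk⟩) else iter step θ₀ h k

/-- Joint law of the first `k` batches of samples: given the batches drawn so far, with current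
iterate `θ_k`, the next batch consists of `M` independent samples from `Q θ_k`. -/
def samplesLaw {M : ℕ} (step : Param n → (Fin M → X) → Param n) (θ₀ : Param n)
    (Q : Param n → Measure X) : (k : ℕ) → Measure (Fin k → Fin M → X)
  | 0 => Measure.dirac Fin.elim0
  | k + 1 => (samplesLaw step θ₀ Q k).bind fun h =>
      (Measure.pi fun _ : Fin M => Q (iter step θ₀ h k)).map
        fun x => Fin.snoc (α := fun _ => Fin M → X) h x

end MCMCLearning

end

/-!
The gradient of the objective is `E_{p_θ} t - t̄ + λ θ`, so each update is a projected gradient step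
with the error `e_k = (1/M) ∑ᵢ t(xᵢ) - E_{p_θ} t` at `θ = θ_k`. Convexity and the descent lemma show
that the distance to the minimizer grows by at most `2 ‖e_k‖ / L` per step, and telescoping bounds
the suboptimality of the averaged iterate by `L / (2K) (‖θ₀ - θ*‖ + (2 / L) ∑ₖ ‖e_k‖)²`.

The error `e_k` is the sum of a bias and a sampling error. The bias is at most `2 R₂` times the
total variation distance between `q_k` and `p_θ`. Given the past, the norm of the sampling error is
a function of `M` independent samples with differences bounded by `2 R₂ / M`; its mean is at most
`R₂ / √M` and by McDiarmid's inequality it is sub-Gaussian about its mean, with variance proxy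
`R₂² / M`. Multiplying the conditional moment generating functions along the iterations and applying
Markov's inequality bounds the total sampling error with probability at least `1 - δ`.
-/

noncomputable section

namespace MCMCLearning

open scoped RealInnerProductSpace Topology NNReal ENNReal

section ConvexOptimization

variable {E : Type*} [NormedAddCommGroup E] [InnerProductSpace ℝ E]
  {f : E → ℝ} {g : E → E} {L : ℝ}

theorem convexOn_univ_of_subgradient (hf : ∀ x y, f x + ⟪g x, y - x⟫ ≤ f y) :
    ConvexOn ℝ Set.univ f := by
  refine ⟨convex_univ, fun x _ y _ a b ha hb hab => ?_⟩
  set w := a • x + b • y with hw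
  have hzero : a * ⟪g w, x - w⟫ + b * ⟪g w, y - w⟫ = 0 := by
    rw [← real_inner_smul_right, ← real_inner_smul_right, ← inner_add_right, smul_sub, smul_sub,
      sub_add_sub_comm, ← hw, ← add_smul, hab, one_smul, sub_self, inner_zero_right]
  have hx := mul_le_mul_of_nonneg_left (hf w x) ha
  have hy := mul_le_mul_of_nonneg_left (hf w y) hb
  have hfw : f w = a * f w + b * f w := by rw [← add_mul, hab, one_mul]
  simp only [smul_eq_mul]
  linarith

theorem sub_sub_inner_le_of_lipschitz_subgradient (hf : ∀ x y, f x + ⟪g x, y - x⟫ ≤ f y)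
    (hg : ∀ x y, ‖g x - g y‖ ≤ L * ‖x - y‖) (x y : E) :
    f y - f x - ⟪g x, y - x⟫ ≤ L * ‖y - x‖ ^ 2 :=
  calc f y - f x - ⟪g x, y - x⟫ ≤ ⟪g y - g x, y - x⟫ := by
        have hyx := hf y x
        rw [← neg_sub y x, inner_neg_right] at hyx
        rw [inner_sub_left]
        linarith
    _ ≤ ‖g y - g x‖ * ‖y - x‖ := real_inner_le_norm _ _
    _ ≤ L * ‖y - x‖ * ‖y - x‖ := by gcongr; exact hg y x
    _ = L * ‖y - x‖ ^ 2 := by ring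

theorem hasGradientAt_of_lipschitz_subgradient [CompleteSpace E]
    (hf : ∀ x y, f x + ⟪g x, y - x⟫ ≤ f y) (hg : ∀ x y, ‖g x - g y‖ ≤ L * ‖x - y‖) (x : E) :
    HasGradientAt f (g x) x := by
  rw [hasGradientAt_iff_isLittleO]
  have hquad : (fun y => f y - f x - ⟪g x, y - x⟫) =O[𝓝 x] fun y => ‖y - x‖ ^ 2 := by
    refine .of_bound L (.of_forall fun y => ?_)
    rw [Real.norm_of_nonneg (by linarith [hf x y]), Real.norm_of_nonneg (by positivity)]
    exact sub_sub_inner_le_of_lipschitz_subgradient hf hg x y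
  exact hquad.trans_isLittleO (Asymptotics.isLittleO_pow_sub_sub x one_lt_two)

theorem le_quadratic_of_lipschitz_gradient [CompleteSpace E] (hf : ∀ x, HasGradientAt f (g x) x)
    (hg : ∀ x y, ‖g x - g y‖ ≤ L * ‖x - y‖) (x y : E) :
    f y ≤ f x + ⟪g x, y - x⟫ + L / 2 * ‖y - x‖ ^ 2 := by
  set h := y - x with hh
  have hline (s : ℝ) : HasDerivAt (fun s : ℝ => f (x + s • h)) ⟪g (x + s • h), h⟫ s := by
    have hxh : HasDerivAt (fun s : ℝ => x + s • h) h s := by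
      simpa using ((hasDerivAt_id s).smul_const h).const_add x
    exact (hf (x + s • h)).hasFDerivAt.comp_hasDerivAt s hxh
  have hbound (s : ℝ) :
      HasDerivAt (fun s => f x + ⟪g x, h⟫ * s + L / 2 * ‖h‖ ^ 2 * s ^ 2)
        (⟪g x, h⟫ + L * ‖h‖ ^ 2 * s) s := by
    have := (((hasDerivAt_id s).const_mul ⟪g x, h⟫).const_add (f x)).add
      ((hasDerivAt_pow 2 s).const_mul (L / 2 * ‖h‖ ^ 2))
    refine this.congr_deriv ?_
    push_cast
    ring
  have hderiv (s : ℝ) (hs : 0 ≤ s) : ⟪g (x + s • h), h⟫ ≤ ⟪g x, h⟫ + L * ‖h‖ ^ 2 * s := by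
    rw [← sub_le_iff_le_add', ← inner_sub_left]
    calc ⟪g (x + s • h) - g x, h⟫ ≤ ‖g (x + s • h) - g x‖ * ‖h‖ := real_inner_le_norm _ _
      _ ≤ L * ‖x + s • h - x‖ * ‖h‖ := by gcongr; exact hg _ _
      _ = L * ‖h‖ ^ 2 * s := by
        rw [add_sub_cancel_left, norm_smul, Real.norm_of_nonneg hs]; ring
  have hle := image_le_of_deriv_right_le_deriv_boundary (a := 0) (b := 1)
    (fun s _ => (hline s).continuousAt.continuousWithinAt) (fun s _ => (hline s).hasDerivWithinAt)
    (by simp) (fun s _ => (hbound s).continuousAt.continuousWithinAt)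
    (fun s _ => (hbound s).hasDerivWithinAt) (fun s hs => hderiv s hs.1)
    (Set.right_mem_Icc.2 zero_le_one)
  simpa [hh] using hle

theorem norm_sub_le_of_inner_nonpos {x y p q : E} (hp : ⟪x - p, q - p⟫ ≤ 0)
    (hq : ⟪y - q, p - q⟫ ≤ 0) : ‖p - q‖ ≤ ‖x - y‖ := by
  have hsq : ‖p - q‖ ^ 2 ≤ ‖x - y‖ * ‖p - q‖ :=
    calc ‖p - q‖ ^ 2 = ⟪x - y, p - q⟫ + ⟪x - p, q - p⟫ + ⟪y - q, p - q⟫ := by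
          rw [← real_inner_self_eq_norm_sq, ← neg_sub p q, inner_neg_right]
          simp only [inner_sub_left, inner_sub_right]
          ring
      _ ≤ ⟪x - y, p - q⟫ := by linarith
      _ ≤ ‖x - y‖ * ‖p - q‖ := real_inner_le_norm _ _
  nlinarith [norm_nonneg (p - q), norm_nonneg (x - y)]

/- The hypothesis `hw` is the variational inequality at `u` that characterizes `w` as the projection
of the gradient step onto a convex set containing `u`. -/
theorem projected_gradient_step_le (hL : 0 < L) (hlow : ∀ x y, f x + ⟪g x, y - x⟫ ≤ f y)
    (hup : ∀ x y, f y ≤ f x + ⟪g x, y - x⟫ + L / 2 * ‖y - x‖ ^ 2) {x e w u : E}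
    (hw : ⟪x - (1 / L) • (g x + e) - w, u - w⟫ ≤ 0) :
    2 / L * (f w - f u) + ‖w - u‖ ^ 2 ≤ ‖x - u‖ ^ 2 + 2 / L * ‖e‖ * ‖w - u‖ := by
  have hgap : f w - f u ≤ ⟪g x, w - u⟫ + L / 2 * ‖x - w‖ ^ 2 := by
    have hsplit : ⟪g x, w - x⟫ = ⟪g x, w - u⟫ + ⟪g x, u - x⟫ := by
      rw [← inner_add_right, sub_add_sub_cancel]
    have hxw := hup x w
    rw [norm_sub_rev w x] at hxw
    linarith [hlow x u]
  have hproj : 1 / L * ⟪g x + e, w - u⟫ ≤ ⟪x - w, w - u⟫ := by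
    rw [← neg_sub w u, inner_neg_right, sub_right_comm, inner_sub_left, real_inner_smul_left] at hw
    linarith
  have herr : -⟪e, w - u⟫ ≤ ‖e‖ * ‖w - u‖ := by
    linarith [neg_le_of_abs_le (abs_real_inner_le_norm e (w - u))]
  have hpyth : ‖x - u‖ ^ 2 = ‖x - w‖ ^ 2 + 2 * ⟪x - w, w - u⟫ + ‖w - u‖ ^ 2 := by
    rw [← norm_add_sq_real, sub_add_sub_cancel]
  calc 2 / L * (f w - f u) + ‖w - u‖ ^ 2
      ≤ 2 / L * (⟪g x, w - u⟫ + L / 2 * ‖x - w‖ ^ 2) + ‖w - u‖ ^ 2 := by gcongr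
    _ = 2 * (1 / L * ⟪g x + e, w - u⟫) + ‖x - w‖ ^ 2 + ‖w - u‖ ^ 2 + 2 / L * -⟪e, w - u⟫ := by
        rw [inner_add_left]; field_simp; ring
    _ ≤ 2 * ⟪x - w, w - u⟫ + ‖x - w‖ ^ 2 + ‖w - u‖ ^ 2 + 2 / L * (‖e‖ * ‖w - u‖) := by gcongr
    _ = ‖x - u‖ ^ 2 + 2 / L * ‖e‖ * ‖w - u‖ := by rw [hpyth]; ring

theorem le_add_and_add_sq_le_of_perturbed_step {d d' a η Δ S : ℝ} (hd : 0 ≤ d) (hη : 0 ≤ η)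
    (hΔ : 0 ≤ Δ) (hstep : Δ + d' ^ 2 ≤ d ^ 2 + η * d') (hda : d ≤ a)
    (hS : S + d ^ 2 ≤ a ^ 2) :
    d' ≤ a + η ∧ S + Δ + d' ^ 2 ≤ (a + η) ^ 2 := by
  have hd' : d' ≤ d + η := by
    by_contra! hlt
    nlinarith
  have hηd' : η * d' ≤ η * (a + η) := mul_le_mul_of_nonneg_left (by linarith) hη
  exact ⟨by linarith, by nlinarith⟩

variable {x e : ℕ → E} {u : E} {K : ℕ}

theorem projected_gradient_norm_sub_le_and_potential_le (hL : 0 < L)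
    (hlow : ∀ x y, f x + ⟪g x, y - x⟫ ≤ f y)
    (hup : ∀ x y, f y ≤ f x + ⟪g x, y - x⟫ + L / 2 * ‖y - x‖ ^ 2)
    (hstep : ∀ k < K, ⟪x k - (1 / L) • (g (x k) + e k) - x (k + 1), u - x (k + 1)⟫ ≤ 0)
    (hmin : ∀ k < K, f u ≤ f (x (k + 1))) :
    ‖x K - u‖ ≤ ‖x 0 - u‖ + ∑ k ∈ Finset.range K, 2 / L * ‖e k‖ ∧
      ∑ k ∈ Finset.range K, 2 / L * (f (x (k + 1)) - f u) + ‖x K - u‖ ^ 2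
        ≤ (‖x 0 - u‖ + ∑ k ∈ Finset.range K, 2 / L * ‖e k‖) ^ 2 := by
  induction K with
  | zero => simp
  | succ K ih =>
    obtain ⟨hdist, hsum⟩ := ih (fun k hk => hstep k (by lia)) fun k hk => hmin k (by lia)
    have hgap : 0 ≤ f (x (K + 1)) - f u := sub_nonneg.2 (hmin K K.lt_succ_self)
    rw [Finset.sum_range_succ, Finset.sum_range_succ, ← add_assoc]
    exact le_add_and_add_sq_le_of_perturbed_step (norm_nonneg _) (by positivity) (by positivity)
      (projected_gradient_step_le hL hlow hup (hstep K K.lt_succ_self)) hdist hsum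

theorem projected_gradient_average_sub_le (hL : 0 < L)
    (hlow : ∀ x y, f x + ⟪g x, y - x⟫ ≤ f y)
    (hup : ∀ x y, f y ≤ f x + ⟪g x, y - x⟫ + L / 2 * ‖y - x‖ ^ 2) (hK : 0 < K)
    (hstep : ∀ k < K, ⟪x k - (1 / L) • (g (x k) + e k) - x (k + 1), u - x (k + 1)⟫ ≤ 0)
    (hmin : ∀ k < K, f u ≤ f (x (k + 1))) :
    f ((1 / (K : ℝ)) • ∑ k ∈ Finset.Icc 1 K, x k) - f u
      ≤ L / (2 * K) * (‖x 0 - u‖ + 2 / L * ∑ k ∈ Finset.range K, ‖e k‖) ^ 2 := by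
  have hK' : (0 : ℝ) < K := by exact_mod_cast hK
  have hIcc : ∑ k ∈ Finset.Icc 1 K, x k = ∑ k ∈ Finset.range K, x (k + 1) := by
    rw [Finset.range_eq_Ico, Finset.sum_Ico_add' x 0 K 1, zero_add, Finset.Ico_add_one_right_eq_Icc]
  have hjensen : f ((1 / (K : ℝ)) • ∑ k ∈ Finset.Icc 1 K, x k)
      ≤ ∑ k ∈ Finset.range K, 1 / (K : ℝ) * f (x (k + 1)) := by
    rw [hIcc, Finset.smul_sum]
    exact (convexOn_univ_of_subgradient hlow).map_sum_le (fun _ _ => by positivity)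
      (by simp [hK'.ne']) fun _ _ => Set.mem_univ _
  obtain ⟨-, hsum⟩ := projected_gradient_norm_sub_le_and_potential_le hL hlow hup hstep hmin
  rw [← Finset.mul_sum, ← Finset.mul_sum] at hsum
  calc f ((1 / (K : ℝ)) • ∑ k ∈ Finset.Icc 1 K, x k) - f u
      ≤ ∑ k ∈ Finset.range K, 1 / (K : ℝ) * f (x (k + 1)) - f u := by gcongr
    _ = L / (2 * K) * (2 / L * ∑ k ∈ Finset.range K, (f (x (k + 1)) - f u)) := by
        rw [← Finset.mul_sum, Finset.sum_sub_distrib, Finset.sum_const, Finset.card_range,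
          nsmul_eq_mul]
        field_simp
    _ ≤ L / (2 * K) * (‖x 0 - u‖ + 2 / L * ∑ k ∈ Finset.range K, ‖e k‖) ^ 2 := by
        gcongr
        linarith [sq_nonneg ‖x K - u‖]

end ConvexOptimization

section Projection

variable {n : ℕ} {Θ : Set (Param n)} (hne : Θ.Nonempty) (hconv : Convex ℝ Θ) (hclosed : IsClosed Θ)

include hne hconv hclosed

theorem proj_mem_and_norm_sub_eq_iInf (φ : Param n) :
    proj Θ φ ∈ Θ ∧ ‖φ - proj Θ φ‖ = ⨅ w : Θ, ‖φ - w‖ := by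
  have hbdd : BddBelow (Set.range fun w : Θ => ‖φ - w‖) :=
    ⟨0, Set.forall_mem_range.2 fun _ => norm_nonneg _⟩
  have hex : ∃ θ, θ ∈ Θ ∧ ∀ θ' ∈ Θ, ‖θ - φ‖ ≤ ‖θ' - φ‖ := by
    obtain ⟨w, hw, hmin⟩ := exists_norm_eq_iInf_of_complete_convex hne hclosed.isComplete hconv φ
    refine ⟨w, hw, fun θ' hθ' => ?_⟩
    rw [norm_sub_rev, hmin, norm_sub_rev θ']
    exact ciInf_le hbdd ⟨θ', hθ'⟩
  obtain ⟨hmem, hmin⟩ := Classical.epsilon_spec hex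
  have : Nonempty Θ := hne.to_subtype
  refine ⟨hmem, le_antisymm (le_ciInf fun w => ?_) (ciInf_le hbdd ⟨_, hmem⟩)⟩
  rw [norm_sub_rev, norm_sub_rev φ]
  exact hmin w w.2

theorem proj_mem (φ : Param n) : proj Θ φ ∈ Θ :=
  (proj_mem_and_norm_sub_eq_iInf hne hconv hclosed φ).1

theorem inner_sub_proj_nonpos (φ : Param n) {u : Param n} (hu : u ∈ Θ) :
    ⟪φ - proj Θ φ, u - proj Θ φ⟫ ≤ 0 := by
  obtain ⟨hmem, hmin⟩ := proj_mem_and_norm_sub_eq_iInf hne hconv hclosed φ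
  exact (norm_eq_iInf_iff_real_inner_le_zero hconv hmem).1 hmin u hu

theorem lipschitzWith_proj : LipschitzWith 1 (proj Θ) :=
  .of_dist_le_mul fun φ ψ => by
    rw [dist_eq_norm, dist_eq_norm, NNReal.coe_one, one_mul]
    exact norm_sub_le_of_inner_nonpos
      (inner_sub_proj_nonpos hne hconv hclosed φ (proj_mem hne hconv hclosed ψ))
      (inner_sub_proj_nonpos hne hconv hclosed ψ (proj_mem hne hconv hclosed φ))

end Projection

theorem abs_exp_sub_exp_le (a b : ℝ) :
    |Real.exp a - Real.exp b| ≤ |a - b| * (Real.exp a + Real.exp b) := by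
  wlog h : b ≤ a generalizing a b
  · rw [abs_sub_comm, abs_sub_comm a b, add_comm]
    exact this b a (le_of_not_ge h)
  have htangent : Real.exp a * (b - a + 1) ≤ Real.exp b :=
    calc Real.exp a * (b - a + 1) ≤ Real.exp a * Real.exp (b - a) := by
          gcongr; exact Real.add_one_le_exp _
      _ = Real.exp b := by rw [← Real.exp_add, add_sub_cancel]
  rw [abs_of_nonneg (sub_nonneg.2 (Real.exp_le_exp.2 h)), abs_of_nonneg (sub_nonneg.2 h)]
  linarith [mul_nonneg (sub_nonneg.2 h) (Real.exp_pos b).le]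

section ExponentialFamily

variable {n : ℕ} {X : Type*} [MeasurableSpace X]

/-- The mean `E_{p_θ} t` of the sufficient statistics, which is the gradient of the log-partition
function at `θ`. -/
def meanStat (ν : Measure X) (t : X → Param n) (θ : Param n) : Param n :=
  ∫ x, t x ∂(expFamily ν t θ)

/-- The gradient of `negLogLik` at `θ` in closed form. -/
def gradLik (ν : Measure X) (t : X → Param n) (lam : ℝ) {D : ℕ} (z : Fin D → X)
    (θ : Param n) : Param n :=
  meanStat ν t θ - empMean t z + lam • θ

theorem negLogLik_eq (ν : Measure X) (t : X → Param n) (lam : ℝ) {D : ℕ} (hD : 0 < D)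
    (z : Fin D → X) (θ : Param n) :
    negLogLik ν t lam z θ
      = logPartition ν t θ - ⟪empMean t z, θ⟫ + lam / 2 * ‖θ‖ ^ 2 := by
  simp only [negLogLik, density, Real.log_exp, empMean, Finset.sum_sub_distrib,
    real_inner_smul_right, inner_sum, Finset.sum_const, Finset.card_univ, Fintype.card_fin,
    nsmul_eq_mul, real_inner_comm θ]
  field_simp
  ring

variable {ν : Measure X} [IsFiniteMeasure ν] {t : X → Param n} (ht : Measurable t)
  {R : ℝ} (htR : ∀ x, ‖t x‖ ≤ R)

include ht htR

theorem integrable_exp_inner (θ : Param n) : Integrable (fun x => Real.exp ⟪θ, t x⟫) ν := by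
  refine .of_bound (by fun_prop) (Real.exp (‖θ‖ * R)) (.of_forall fun x => ?_)
  rw [Real.norm_eq_abs, Real.abs_exp, Real.exp_le_exp]
  exact (real_inner_le_norm _ _).trans (by gcongr; exact htR x)

variable [NeZero ν]

theorem exp_logPartition (θ : Param n) :
    Real.exp (logPartition ν t θ) = ∫ x, Real.exp ⟪θ, t x⟫ ∂ν :=
  Real.exp_log (integral_exp_pos (integrable_exp_inner ht htR θ))

theorem density_eq_exp_div (θ : Param n) (x : X) :
    density ν t θ x = Real.exp ⟪θ, t x⟫ / ∫ y, Real.exp ⟪θ, t y⟫ ∂ν := by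
  rw [density, Real.exp_sub, exp_logPartition ht htR]

theorem integrable_density (θ : Param n) : Integrable (density ν t θ) ν := by
  rw [funext (density_eq_exp_div ht htR θ)]
  exact (integrable_exp_inner ht htR θ).div_const _

theorem expFamily_eq_tilted (θ : Param n) :
    expFamily ν t θ = ν.tilted fun x => ⟪θ, t x⟫ := by
  simp only [expFamily, density_eq_exp_div ht htR, Measure.tilted]

theorem isProbabilityMeasure_expFamily (θ : Param n) :
    IsProbabilityMeasure (expFamily ν t θ) := by
  rw [expFamily_eq_tilted ht htR]
  exact isProbabilityMeasure_tilted (integrable_exp_inner ht htR θ)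

theorem integral_expFamily {E : Type*} [NormedAddCommGroup E] [NormedSpace ℝ E] (θ : Param n)
    (g : X → E) : ∫ x, g x ∂(expFamily ν t θ) = ∫ x, density ν t θ x • g x ∂ν := by
  simp only [expFamily_eq_tilted ht htR, integral_tilted, density_eq_exp_div ht htR]

theorem integral_density (θ : Param n) : ∫ x, density ν t θ x ∂ν = 1 := by
  have := isProbabilityMeasure_expFamily (ν := ν) ht htR θ
  simpa using (integral_expFamily (ν := ν) ht htR θ fun _ => (1 : ℝ)).symm

theorem norm_meanStat_le (θ : Param n) : ‖meanStat ν t θ‖ ≤ R := by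
  have := isProbabilityMeasure_expFamily (ν := ν) ht htR θ
  simpa [meanStat] using
    norm_integral_le_of_norm_le_const (μ := expFamily ν t θ) (.of_forall htR)

theorem integral_exp_inner_sub_expFamily (θ φ : Param n) :
    ∫ x, Real.exp ⟪φ - θ, t x⟫ ∂(expFamily ν t θ)
      = Real.exp (logPartition ν t φ - logPartition ν t θ) := by
  simp only [expFamily_eq_tilted ht htR, integral_exp_tilted, Pi.add_apply, ← inner_add_left,
    add_sub_cancel, Real.exp_sub, exp_logPartition ht htR]

theorem logPartition_add_inner_le (θ φ : Param n) :
    logPartition ν t θ + ⟪meanStat ν t θ, φ - θ⟫ ≤ logPartition ν t φ := by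
  have := isProbabilityMeasure_expFamily (ν := ν) ht htR θ
  have ht_int : Integrable t (expFamily ν t θ) :=
    .of_bound ht.aestronglyMeasurable R (.of_forall htR)
  have hmean : ∫ x, ⟪φ - θ, t x⟫ ∂(expFamily ν t θ) = ⟪meanStat ν t θ, φ - θ⟫ := by
    rw [integral_inner ht_int, meanStat, real_inner_comm]
  have hjensen := convexOn_exp.map_integral_le Real.continuous_exp.continuousOn isClosed_univ
    (.of_forall fun _ => Set.mem_univ _) (ht_int.const_inner (φ - θ))
    (integrable_exp_inner ht htR (φ - θ))
  rw [hmean, integral_exp_inner_sub_expFamily ht htR, Real.exp_le_exp] at hjensen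
  linarith

theorem abs_logPartition_sub_le (θ φ : Param n) :
    |logPartition ν t θ - logPartition ν t φ| ≤ R * ‖θ - φ‖ := by
  have hsub (θ φ : Param n) : logPartition ν t θ - logPartition ν t φ ≤ R * ‖θ - φ‖ :=
    calc logPartition ν t θ - logPartition ν t φ ≤ ⟪meanStat ν t θ, θ - φ⟫ := by
          have htangent := logPartition_add_inner_le (ν := ν) ht htR θ φ
          rw [← neg_sub, inner_neg_right] at htangent
          linarith
      _ ≤ ‖meanStat ν t θ‖ * ‖θ - φ‖ := real_inner_le_norm _ _
      _ ≤ R * ‖θ - φ‖ := by gcongr; exact norm_meanStat_le ht htR θ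
  exact abs_sub_le_iff.2 ⟨hsub θ φ, norm_sub_rev θ φ ▸ hsub φ θ⟩

theorem abs_density_sub_le (θ φ : Param n) (x : X) :
    |density ν t θ x - density ν t φ x|
      ≤ 2 * R * ‖θ - φ‖ * (density ν t θ x + density ν t φ x) := by
  refine (abs_exp_sub_exp_le _ _).trans
    (mul_le_mul_of_nonneg_right ?_ (add_pos (Real.exp_pos _) (Real.exp_pos _)).le)
  calc |⟪θ, t x⟫ - logPartition ν t θ - (⟪φ, t x⟫ - logPartition ν t φ)|
      = |⟪θ - φ, t x⟫ - (logPartition ν t θ - logPartition ν t φ)| := by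
        rw [inner_sub_left, sub_sub_sub_comm]
    _ ≤ |⟪θ - φ, t x⟫| + |logPartition ν t θ - logPartition ν t φ| := abs_sub _ _
    _ ≤ ‖θ - φ‖ * R + R * ‖θ - φ‖ := by
        gcongr
        · exact (abs_real_inner_le_norm _ _).trans (by gcongr; exact htR x)
        · exact abs_logPartition_sub_le ht htR θ φ
    _ = 2 * R * ‖θ - φ‖ := by ring

theorem norm_meanStat_sub_le (θ φ : Param n) :
    ‖meanStat ν t θ - meanStat ν t φ‖ ≤ 4 * R ^ 2 * ‖θ - φ‖ := by
  have hdens (θ : Param n) := integrable_density (ν := ν) ht htR θ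
  have hsmul (θ : Param n) : Integrable (fun x => density ν t θ x • t x) ν :=
    (hdens θ).smul_bdd R ht.aestronglyMeasurable (.of_forall htR)
  have hpoint (x : X) : ‖density ν t θ x • t x - density ν t φ x • t x‖
      ≤ 2 * R * ‖θ - φ‖ * R * (density ν t θ x + density ν t φ x) := by
    have hsub := abs_density_sub_le (ν := ν) ht htR θ φ x
    rw [← sub_smul, norm_smul, Real.norm_eq_abs]
    calc |density ν t θ x - density ν t φ x| * ‖t x‖
        ≤ 2 * R * ‖θ - φ‖ * (density ν t θ x + density ν t φ x) * R :=
          mul_le_mul hsub (htR x) (norm_nonneg _) ((abs_nonneg _).trans hsub)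
      _ = 2 * R * ‖θ - φ‖ * R * (density ν t θ x + density ν t φ x) := by ring
  rw [meanStat, meanStat, integral_expFamily ht htR, integral_expFamily ht htR,
    ← integral_sub (hsmul θ) (hsmul φ)]
  calc ‖∫ x, (density ν t θ x • t x - density ν t φ x • t x) ∂ν‖
      ≤ ∫ x, 2 * R * ‖θ - φ‖ * R * (density ν t θ x + density ν t φ x) ∂ν :=
        norm_integral_le_of_norm_le (((hdens θ).add (hdens φ)).const_mul _) (.of_forall hpoint)
    _ = 4 * R ^ 2 * ‖θ - φ‖ := by
        rw [integral_const_mul, integral_add (hdens θ) (hdens φ), integral_density ht htR,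
          integral_density ht htR]
        ring

variable {lam : ℝ} (hlam : 0 ≤ lam) {D : ℕ}

include hlam

theorem norm_gradLik_sub_le (z : Fin D → X) (θ φ : Param n) :
    ‖gradLik ν t lam z θ - gradLik ν t lam z φ‖ ≤ (4 * R ^ 2 + lam) * ‖θ - φ‖ := by
  calc ‖gradLik ν t lam z θ - gradLik ν t lam z φ‖
      = ‖(meanStat ν t θ - meanStat ν t φ) + lam • (θ - φ)‖ := by
        rw [gradLik, gradLik, add_sub_add_comm, sub_sub_sub_cancel_right, smul_sub]
    _ ≤ ‖meanStat ν t θ - meanStat ν t φ‖ + ‖lam • (θ - φ)‖ := norm_add_le _ _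
    _ ≤ 4 * R ^ 2 * ‖θ - φ‖ + lam * ‖θ - φ‖ := by
        rw [norm_smul, Real.norm_of_nonneg hlam]
        gcongr
        exact norm_meanStat_sub_le ht htR θ φ
    _ = (4 * R ^ 2 + lam) * ‖θ - φ‖ := by ring

variable (hD : 0 < D) (z : Fin D → X)

include hD

theorem negLogLik_add_inner_le (θ φ : Param n) :
    negLogLik ν t lam z θ + ⟪gradLik ν t lam z θ, φ - θ⟫ ≤ negLogLik ν t lam z φ := by
  have htangent := logPartition_add_inner_le (ν := ν) ht htR θ φ
  have hnorm : ‖φ‖ ^ 2 = ‖θ‖ ^ 2 + 2 * ⟪θ, φ - θ⟫ + ‖φ - θ‖ ^ 2 := by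
    rw [← norm_add_sq_real, add_sub_cancel]
  have hlinear : ⟪empMean t z, φ⟫ = ⟪empMean t z, θ⟫ + ⟪empMean t z, φ - θ⟫ := by
    rw [← inner_add_right, add_sub_cancel]
  rw [negLogLik_eq ν t lam hD, negLogLik_eq ν t lam hD, hnorm, hlinear]
  simp only [gradLik, inner_add_left, inner_sub_left, real_inner_smul_left]
  linarith [mul_nonneg hlam (sq_nonneg ‖φ - θ‖)]

theorem hasGradientAt_negLogLik (θ : Param n) :
    HasGradientAt (negLogLik ν t lam z) (gradLik ν t lam z θ) θ :=
  hasGradientAt_of_lipschitz_subgradient (negLogLik_add_inner_le ht htR hlam hD z)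
    (norm_gradLik_sub_le ht htR hlam z) θ

theorem gradient_negLogLik (θ : Param n) :
    gradient (negLogLik ν t lam z) θ = gradLik ν t lam z θ :=
  (hasGradientAt_negLogLik ht htR hlam hD z θ).gradient

theorem hasLipschitzGradient_negLogLik :
    HasLipschitzGradient (negLogLik ν t lam z) (4 * R ^ 2 + lam) := by
  refine ⟨fun θ => (hasGradientAt_negLogLik ht htR hlam hD z θ).differentiableAt, fun θ φ => ?_⟩
  simp only [gradient_negLogLik ht htR hlam hD z]
  exact norm_gradLik_sub_le ht htR hlam z θ φ

end ExponentialFamily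

section TotalVariation

variable {X : Type*} [MeasurableSpace X] (p q : Measure X)

theorem abs_measureReal_sub_le_tvDist [IsFiniteMeasure p] [IsFiniteMeasure q] {A : Set X}
    (hA : MeasurableSet A) : |p.real A - q.real A| ≤ tvDist p q := by
  refine le_ciSup (f := fun A : {A : Set X // MeasurableSet A} => |p.real A - q.real A|)
    ⟨p.real Set.univ + q.real Set.univ, Set.forall_mem_range.2 fun B => ?_⟩ ⟨A, hA⟩
  refine (abs_sub _ _).trans ?_
  rw [abs_of_nonneg measureReal_nonneg, abs_of_nonneg measureReal_nonneg]
  exact add_le_add (measureReal_mono (Set.subset_univ _)) (measureReal_mono (Set.subset_univ _))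

theorem integral_sub_le_tvDist [IsFiniteMeasure p] [IsFiniteMeasure q] {f : X → ℝ}
    (hf : Measurable f) {B : ℝ} (hB : 0 ≤ B) (hfB : ∀ x, f x ∈ Set.Icc 0 B) :
    ∫ x, f x ∂p - ∫ x, f x ∂q ≤ B * tvDist p q := by
  have hlayer (μ : Measure X) [IsFiniteMeasure μ] :
      ∫ x, f x ∂μ = ∫ s in Set.Ioc 0 B, μ.real {a | s ≤ f a} :=
    (Integrable.of_mem_Icc 0 B hf.aemeasurable (.of_forall hfB)).integral_eq_integral_Ioc_meas_le
      (.of_forall fun x => (hfB x).1) (.of_forall fun x => (hfB x).2)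
  have hint (μ : Measure X) [IsFiniteMeasure μ] :
      IntegrableOn (fun s => μ.real {a | s ≤ f a}) (Set.Ioc 0 B) := by
    have hanti : Antitone fun s => μ.real {a | s ≤ f a} := fun s s' hs =>
      measureReal_mono fun a (ha : s' ≤ f a) => hs.trans ha
    refine .of_bound measure_Ioc_lt_top hanti.measurable.aestronglyMeasurable (μ.real Set.univ)
      (.of_forall fun s => ?_)
    rw [Real.norm_of_nonneg measureReal_nonneg]
    exact measureReal_mono (Set.subset_univ _)
  rw [hlayer p, hlayer q, ← integral_sub (hint p) (hint q)]
  calc ∫ s in Set.Ioc 0 B, (p.real {a | s ≤ f a} - q.real {a | s ≤ f a})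
      ≤ ∫ _ in Set.Ioc 0 B, tvDist p q :=
        integral_mono ((hint p).sub (hint q)) (integrable_const _) fun s =>
          (le_abs_self _).trans
            (abs_measureReal_sub_le_tvDist p q (measurableSet_le measurable_const hf))
    _ = B * tvDist p q := by simp [hB]

theorem norm_integral_sub_le_tvDist [IsProbabilityMeasure p] [IsProbabilityMeasure q]
    {E : Type*} [NormedAddCommGroup E] [NormedSpace ℝ E] [CompleteSpace E] {t : X → E}
    (ht : StronglyMeasurable t) {R : ℝ} (htR : ∀ x, ‖t x‖ ≤ R) :
    ‖∫ x, t x ∂p - ∫ x, t x ∂q‖ ≤ 2 * R * tvDist p q := by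
  obtain ⟨x₀⟩ := p.nonempty_of_neZero
  have hR : 0 ≤ R := (norm_nonneg _).trans (htR x₀)
  have ht_int (μ : Measure X) [IsProbabilityMeasure μ] : Integrable t μ :=
    .of_bound ht.aestronglyMeasurable R (.of_forall htR)
  obtain ⟨g, hg, hgw⟩ := exists_dual_vector'' ℝ (∫ x, t x ∂p - ∫ x, t x ∂q)
  have hgt (x : X) : |g (t x)| ≤ R :=
    (g.le_opNorm (t x)).trans (by simpa using mul_le_mul hg (htR x) (norm_nonneg _) zero_le_one)
  have hmean (μ : Measure X) [IsProbabilityMeasure μ] :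
      ∫ x, (g (t x) + R) ∂μ = g (∫ x, t x ∂μ) + R := by
    rw [integral_add (g.integrable_comp (ht_int μ)) (integrable_const R),
      g.integral_comp_comm (ht_int μ)]
    simp
  calc ‖∫ x, t x ∂p - ∫ x, t x ∂q‖ = ∫ x, (g (t x) + R) ∂p - ∫ x, (g (t x) + R) ∂q := by
        rw [hmean, hmean, add_sub_add_right_eq_sub, ← map_sub, hgw]; rfl
    _ ≤ 2 * R * tvDist p q := by
        refine integral_sub_le_tvDist p q ?_ (by positivity) fun x => ?_
        · exact (g.continuous.comp_stronglyMeasurable ht).measurable.add_const R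
        · have := abs_le.1 (hgt x)
          exact ⟨by linarith, by linarith⟩

end TotalVariation

section BoundedDifferences

theorem exists_forall_mem_Icc_of_abs_sub_le {α : Type*} {f : α → ℝ} {c : ℝ}
    (hf : ∀ a b, |f a - f b| ≤ c) : ∃ l, ∀ a, f a ∈ Set.Icc l (l + c) := by
  refine ⟨⨅ a, f a, fun a => ⟨ciInf_le ⟨f a - c, Set.forall_mem_range.2 fun b => ?_⟩ a, ?_⟩⟩
  · linarith [(abs_le.1 (hf a b)).2]
  · have : Nonempty α := ⟨a⟩
    rw [← sub_le_iff_le_add]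
    exact le_ciInf fun b => by linarith [(abs_le.1 (hf a b)).2]

theorem abs_sub_le_sum_of_bounded_differences {ι : Type*} [Fintype ι] [DecidableEq ι]
    {X : ι → Type*} {F : (∀ i, X i) → ℝ} {c : ι → ℝ}
    (hF : ∀ i x a, |F (Function.update x i a) - F x| ≤ c i) (x y : ∀ i, X i) :
    |F y - F x| ≤ ∑ i, c i := by
  suffices h : ∀ s : Finset ι, |F (s.piecewise y x) - F x| ≤ ∑ i ∈ s, c i by
    simpa using h Finset.univ
  intro s
  induction s using Finset.induction_on with
  | empty => simp
  | insert i s hi ih =>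
    rw [Finset.piecewise_insert, Finset.sum_insert hi]
    exact (abs_sub_le _ (F (s.piecewise y x)) _).trans (add_le_add (hF _ _ _) ih)

variable {α β : Type*} [MeasurableSpace α] [MeasurableSpace β] {μ : Measure α} {ν : Measure β}
  [IsProbabilityMeasure μ] [IsProbabilityMeasure ν]

theorem hasSubgaussianMGF_sub_integral_of_abs_sub_le {f : α → ℝ} (hf : AEMeasurable f μ) {c : ℝ≥0}
    (hfc : ∀ a b, |f a - f b| ≤ c) :
    HasSubgaussianMGF (fun a => f a - ∫ b, f b ∂μ) ((c / 2) ^ 2) μ := by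
  obtain ⟨l, hl⟩ := exists_forall_mem_Icc_of_abs_sub_le hfc
  simpa using hasSubgaussianMGF_of_mem_Icc hf (.of_forall hl)

/- Conditioning on the first coordinate: its conditional mean obeys Hoeffding's lemma, and the
fluctuation around the conditional mean is controlled by `hsnd`. -/
theorem hasSubgaussianMGF_sub_integral_prod {F : α × β → ℝ} (hF : Measurable F) {l u : ℝ}
    (hFlu : ∀ p, F p ∈ Set.Icc l u) {c c' : ℝ≥0} (hfst : ∀ a a' b, |F (a, b) - F (a', b)| ≤ c)
    (hsnd : ∀ a, HasSubgaussianMGF (fun b => F (a, b) - ∫ y, F (a, y) ∂ν) c' ν) :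
    HasSubgaussianMGF (fun p => F p - ∫ q, F q ∂(μ.prod ν)) ((c / 2) ^ 2 + c') (μ.prod ν) := by
  set m := ∫ q, F q ∂(μ.prod ν)
  set ψ : α → ℝ := fun a => ∫ b, F (a, b) ∂ν with hψ
  have hF_int : Integrable F (μ.prod ν) := .of_mem_Icc l u hF.aemeasurable (.of_forall hFlu)
  have hF_int' (a : α) : Integrable (fun b => F (a, b)) ν :=
    .of_mem_Icc l u (by fun_prop) (.of_forall fun b => hFlu (a, b))
  have hψ_mean : ∫ a, ψ a ∂μ = m := (integral_prod F hF_int).symm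
  have hψ_meas : Measurable ψ :=
    (hF.stronglyMeasurable.integral_prod_right' (ν := ν)).measurable
  have hψ_osc (a a' : α) : |ψ a - ψ a'| ≤ c := by
    rw [hψ, ← integral_sub (hF_int' a) (hF_int' a')]
    simpa using norm_integral_le_of_norm_le_const (μ := ν) (f := fun b => F (a, b) - F (a', b))
      (.of_forall (hfst a a'))
  have hψ_subG := hasSubgaussianMGF_sub_integral_of_abs_sub_le (μ := μ) hψ_meas.aemeasurable hψ_osc
  rw [hψ_mean] at hψ_subG
  have hexp_int (s : ℝ) : Integrable (fun p => Real.exp (s * (F p - m))) (μ.prod ν) :=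
    integrable_exp_mul_of_mem_Icc (a := l - m) (b := u - m) (by fun_prop)
      (.of_forall fun p => ⟨by linarith [(hFlu p).1], by linarith [(hFlu p).2]⟩)
  refine ⟨hexp_int, fun s => ?_⟩
  calc mgf (fun p => F p - m) (μ.prod ν) s
      = ∫ a, Real.exp (s * (ψ a - m)) * mgf (fun b => F (a, b) - ψ a) ν s ∂μ := by
        rw [mgf, integral_prod _ (hexp_int s)]
        simp only [mgf, ← integral_const_mul, ← Real.exp_add, ← mul_add, sub_add_sub_cancel']
    _ ≤ ∫ a, Real.exp (s * (ψ a - m)) * Real.exp (c' * s ^ 2 / 2) ∂μ := by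
        refine integral_mono_of_nonneg
          (.of_forall fun a => mul_nonneg (Real.exp_pos _).le mgf_nonneg)
          ((hψ_subG.integrable_exp_mul s).mul_const _) (.of_forall fun a => ?_)
        exact mul_le_mul_of_nonneg_left ((hsnd a).mgf_le s) (Real.exp_pos _).le
    _ = mgf (fun a => ψ a - m) μ s * Real.exp (c' * s ^ 2 / 2) := integral_mul_const _ _
    _ ≤ Real.exp (((c / 2) ^ 2 : ℝ≥0) * s ^ 2 / 2) * Real.exp (c' * s ^ 2 / 2) := by
        gcongr; exact hψ_subG.mgf_le s
    _ = Real.exp (((c / 2) ^ 2 + c' : ℝ≥0) * s ^ 2 / 2) := by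
        rw [← Real.exp_add]; push_cast; ring_nf

theorem hasSubgaussianMGF_of_bounded_differences {M : ℕ} {X : Fin M → Type*}
    [∀ i, MeasurableSpace (X i)] (μ : ∀ i, Measure (X i)) [∀ i, IsProbabilityMeasure (μ i)]
    {F : (∀ i, X i) → ℝ} (hF : Measurable F) {c : Fin M → ℝ≥0}
    (hFc : ∀ i x a, |F (Function.update x i a) - F x| ≤ c i) :
    HasSubgaussianMGF (fun x => F x - ∫ y, F y ∂(Measure.pi μ)) (∑ i, (c i / 2) ^ 2)
      (Measure.pi μ) := by
  induction M with
  | zero =>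
    have hconst : (fun x => F x - ∫ y, F y ∂(Measure.pi μ)) = fun _ => 0 := by
      funext x
      simp [Subsingleton.elim _ x]
    simp [hconst]
  | succ M ih =>
    set G : X 0 × (∀ i : Fin M, X i.succ) → ℝ := fun p => F (Fin.cons p.1 p.2) with hG
    let e : (∀ i, X i) ≃ᵐ X 0 × (∀ i : Fin M, X i.succ) := MeasurableEquiv.piFinSuccAbove X 0
    have he : MeasurePreserving e (Measure.pi μ) ((μ 0).prod (Measure.pi fun i => μ i.succ)) :=
      measurePreserving_piFinSuccAbove μ 0
    have hGe : F = G ∘ e := funext fun x => congrArg F (Fin.cons_self_tail x).symm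
    have hG_meas : Measurable G := by
      rw [← e.measurable_comp_iff, ← hGe]
      exact hF
    obtain ⟨l, hl⟩ := exists_forall_mem_Icc_of_abs_sub_le
      fun x y => abs_sub_le_sum_of_bounded_differences hFc y x
    have hfst (a a' : X 0) (x : ∀ i : Fin M, X i.succ) : |G (a, x) - G (a', x)| ≤ c 0 := by
      simpa only [hG, Fin.update_cons_zero] using hFc 0 (Fin.cons a' x) a
    have hsnd (a : X 0) := ih (fun i => μ i.succ) (F := fun x => G (a, x)) (c := fun i => c i.succ)
      (hG_meas.comp measurable_prodMk_left)
      fun i x b => by simpa only [hG, Fin.cons_update] using hFc i.succ (Fin.cons a x) b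
    have hG_subG := hasSubgaussianMGF_sub_integral_prod (μ := μ 0) hG_meas
      (fun p => hl (Fin.cons p.1 p.2)) hfst hsnd
    rw [← he.map_eq] at hG_subG
    have hF_subG := HasSubgaussianMGF.of_map e.measurable.aemeasurable hG_subG
    rw [he.map_eq, ← he.integral_comp'] at hF_subG
    rw [Fin.sum_univ_succ, hGe]
    exact hF_subG

end BoundedDifferences

section SampleMean

variable {E : Type*} [NormedAddCommGroup E] [InnerProductSpace ℝ E]

theorem integrable_inner_of_memLp {Ω : Type*} [MeasurableSpace Ω] {μ : Measure Ω} {f g : Ω → E}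
    (hf : MemLp f 2 μ) (hg : MemLp g 2 μ) : Integrable (fun ω => ⟪f ω, g ω⟫) μ :=
  (hf.norm.integrable_mul hg.norm).mono' (hf.1.inner hg.1)
    (.of_forall fun _ => norm_inner_le_norm _ _)

theorem integral_le_sqrt_integral_sq {Ω : Type*} [MeasurableSpace Ω] {μ : Measure Ω}
    [IsProbabilityMeasure μ] {f : Ω → ℝ} (hf : MemLp f 2 μ) :
    ∫ ω, f ω ∂μ ≤ √(∫ ω, f ω ^ 2 ∂μ) :=
  Real.le_sqrt_of_sq_le (sub_nonneg.1 ((variance_nonneg f μ).trans_eq (variance_eq_sub hf)))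

variable {X : Type*} [MeasurableSpace X]

/-- The distance between the empirical mean of the statistic `t` over the sample `x` and its
expectation under `q`: the statistical error made on one batch. -/
def sampleMeanError (q : Measure X) (t : X → E) {M : ℕ} (x : Fin M → X) : ℝ :=
  ‖(1 / (M : ℝ)) • ∑ i, t (x i) - ∫ y, t y ∂q‖

theorem abs_sampleMeanError_update_sub_le (q : Measure X) {t : X → E} {R : ℝ}
    (htR : ∀ x, ‖t x‖ ≤ R) {M : ℕ} (i : Fin M) (x : Fin M → X) (a : X) :
    |sampleMeanError q t (Function.update x i a) - sampleMeanError q t x| ≤ 2 * R / M := by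
  have hsum : ∑ j, t (Function.update x i a j) - ∑ j, t (x j) = t a - t (x i) := by
    rw [← Finset.sum_sub_distrib, Finset.sum_eq_single_of_mem i (Finset.mem_univ i) fun j _ hj => by
      rw [Function.update_of_ne hj, sub_self], Function.update_self]
  refine (abs_norm_sub_norm_le _ _).trans ?_
  rw [sub_sub_sub_cancel_right, ← smul_sub, hsum, norm_smul, Real.norm_of_nonneg (by positivity),
    div_mul_eq_mul_div, one_mul]
  gcongr
  linarith [norm_sub_le (t a) (t (x i)), htR a, htR (x i)]

theorem measurable_sampleMeanError (q : Measure X) {t : X → E} (ht : StronglyMeasurable t)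
    (M : ℕ) : Measurable (sampleMeanError q t (M := M)) :=
  (StronglyMeasurable.norm (by fun_prop)).measurable

theorem hasSubgaussianMGF_sampleMeanError (q : Measure X) [IsProbabilityMeasure q] {t : X → E}
    (ht : StronglyMeasurable t) {R : ℝ} (hR : 0 ≤ R) (htR : ∀ x, ‖t x‖ ≤ R) {M : ℕ} :
    HasSubgaussianMGF (fun x : Fin M → X =>
        sampleMeanError q t x - ∫ y : Fin M → X, sampleMeanError q t y ∂(Measure.pi fun _ => q))
      (Real.toNNReal (R ^ 2 / M)) (Measure.pi fun _ => q) := by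
  have hcoe : (Real.toNNReal (2 * R / M) : ℝ) = 2 * R / M := Real.coe_toNNReal _ (by positivity)
  have hparam : ∑ _ : Fin M, (Real.toNNReal (2 * R / M) / 2) ^ 2 = Real.toNNReal (R ^ 2 / M) := by
    apply NNReal.coe_injective
    rw [Real.coe_toNNReal _ (by positivity)]
    simp only [Finset.sum_const, Finset.card_univ, Fintype.card_fin, nsmul_eq_mul, NNReal.coe_mul,
      NNReal.coe_natCast, NNReal.coe_pow, NNReal.coe_div, NNReal.coe_ofNat, hcoe]
    rcases M.eq_zero_or_pos with rfl | hM
    · simp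
    · field_simp
  rw [← hparam]
  refine hasSubgaussianMGF_of_bounded_differences _ (measurable_sampleMeanError q ht M)
    (c := fun _ => Real.toNNReal (2 * R / M)) fun i x a => ?_
  rw [hcoe]
  exact abs_sampleMeanError_update_sub_le q htR i x a

variable [CompleteSpace E]

theorem integral_norm_sum_sq_of_indepFun [MeasurableSpace E] [BorelSpace E] {Ω ι : Type*}
    [MeasurableSpace Ω] {μ : Measure Ω} [IsFiniteMeasure μ] [Fintype ι] {Y : ι → Ω → E}
    (hY : ∀ i, MemLp (Y i) 2 μ) (hY₀ : ∀ i, ∫ ω, Y i ω ∂μ = 0)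
    (hind : Pairwise fun i j => IndepFun (Y i) (Y j) μ) :
    ∫ ω, ‖∑ i, Y i ω‖ ^ 2 ∂μ = ∑ i, ∫ ω, ‖Y i ω‖ ^ 2 ∂μ := by
  have horth {i j : ι} (hij : i ≠ j) : ∫ ω, ⟪Y i ω, Y j ω⟫ ∂μ = 0 := by
    have hbilin := (hind hij).integral_bilin ((hY i).integrable one_le_two)
      ((hY j).integrable one_le_two) (innerSL ℝ)
    rw [hY₀, hY₀, map_zero] at hbilin
    exact hbilin
  have hint (i j : ι) := integrable_inner_of_memLp (hY i) (hY j)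
  simp only [← real_inner_self_eq_norm_sq, sum_inner, inner_sum]
  rw [integral_finsetSum _ fun i _ => integrable_finsetSum _ fun j _ => hint j i]
  refine Finset.sum_congr rfl fun i _ => ?_
  rw [integral_finsetSum _ fun j _ => hint j i]
  exact Finset.sum_eq_single_of_mem i (Finset.mem_univ i) fun j _ hji => horth hji

theorem integral_norm_sub_integral_sq_le {Ω : Type*} [MeasurableSpace Ω] {μ : Measure Ω}
    [IsProbabilityMeasure μ] {f : Ω → E} (hf : MemLp f 2 μ) :
    ∫ ω, ‖f ω - ∫ y, f y ∂μ‖ ^ 2 ∂μ ≤ ∫ ω, ‖f ω‖ ^ 2 ∂μ := by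
  set m := ∫ y, f y ∂μ with hm
  have hsq : Integrable (fun ω => ‖f ω‖ ^ 2) μ := hf.integrable_norm_pow two_ne_zero
  have hinner : Integrable (fun ω => ⟪f ω, m⟫) μ := integrable_inner_of_memLp hf (memLp_const m)
  have hinner_mean : ∫ ω, ⟪f ω, m⟫ ∂μ = ‖m‖ ^ 2 := by
    simp_rw [real_inner_comm m]
    rw [integral_inner (hf.integrable one_le_two), ← hm, real_inner_self_eq_norm_sq]
  have hvar : ∫ ω, ‖f ω - m‖ ^ 2 ∂μ = (∫ ω, ‖f ω‖ ^ 2 ∂μ) - ‖m‖ ^ 2 := by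
    simp_rw [norm_sub_sq_real]
    rw [integral_add (f := fun ω => ‖f ω‖ ^ 2 - 2 * ⟪f ω, m⟫) (hsq.sub (hinner.const_mul 2))
        (integrable_const _),
      integral_sub hsq (hinner.const_mul 2), integral_const_mul, hinner_mean]
    simp only [integral_const, probReal_univ, smul_eq_mul, one_mul]
    ring
  linarith [sq_nonneg ‖m‖]

variable (q : Measure X) [IsProbabilityMeasure q] {t : X → E}
  (ht : StronglyMeasurable t) {R : ℝ} (htR : ∀ x, ‖t x‖ ≤ R) {M : ℕ}

include ht htR

theorem integral_norm_sub_integral_sq_le_of_norm_le :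
    ∫ a, ‖t a - ∫ y, t y ∂q‖ ^ 2 ∂q ≤ R ^ 2 := by
  have ht_memLp : MemLp t 2 q := .of_bound ht.aestronglyMeasurable R (.of_forall htR)
  refine (integral_norm_sub_integral_sq_le ht_memLp).trans ?_
  simpa using integral_mono (ht_memLp.integrable_norm_pow two_ne_zero) (integrable_const (R ^ 2))
    fun a => pow_le_pow_left₀ (norm_nonneg _) (htR a) 2

theorem integral_norm_sum_sub_integral_sq_le :
    ∫ x : Fin M → X, ‖∑ i, (t (x i) - ∫ y, t y ∂q)‖ ^ 2 ∂(Measure.pi fun _ => q) ≤ M * R ^ 2 := by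
  borelize E
  set ξ : X → E := fun a => t a - ∫ y, t y ∂q with hξ
  have ht_memLp : MemLp t 2 q := .of_bound ht.aestronglyMeasurable R (.of_forall htR)
  have hξ_memLp : MemLp ξ 2 q := ht_memLp.sub (memLp_const _)
  have hξ_mean : ∫ a, ξ a ∂q = 0 := by
    simp [hξ, integral_sub (ht_memLp.integrable one_le_two) (integrable_const _)]
  have hind : iIndepFun (fun (i : Fin M) (x : Fin M → X) => ξ (x i)) (Measure.pi fun _ => q) :=
    iIndepFun_pi fun _ => hξ_memLp.1.aemeasurable
  have hξ_sq (i : Fin M) :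
      ∫ x : Fin M → X, ‖ξ (x i)‖ ^ 2 ∂(Measure.pi fun _ => q) = ∫ a, ‖ξ a‖ ^ 2 ∂q :=
    integral_comp_eval (X := fun _ => X) (f := fun a => ‖ξ a‖ ^ 2) (hξ_memLp.1.norm.pow 2)
  calc ∫ x : Fin M → X, ‖∑ i, ξ (x i)‖ ^ 2 ∂(Measure.pi fun _ => q)
      = ∑ i : Fin M, ∫ x : Fin M → X, ‖ξ (x i)‖ ^ 2 ∂(Measure.pi fun _ => q) :=
        integral_norm_sum_sq_of_indepFun
          (fun i => hξ_memLp.comp_measurePreserving (measurePreserving_eval _ i))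
          (fun i => (integral_comp_eval (μ := fun _ => q) hξ_memLp.1).trans hξ_mean)
          (fun i j hij => hind.indepFun hij)
    _ = M * ∫ a, ‖ξ a‖ ^ 2 ∂q := by
        simp only [hξ_sq, Finset.sum_const, Finset.card_univ, Fintype.card_fin, nsmul_eq_mul]
    _ ≤ M * R ^ 2 := by
        gcongr
        exact integral_norm_sub_integral_sq_le_of_norm_le q ht htR

theorem integral_sampleMeanError_le (hR : 0 ≤ R) (hM : 0 < M) :
    ∫ x : Fin M → X, sampleMeanError q t x ∂(Measure.pi fun _ => q) ≤ R / √M := by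
  set m := ∫ y, t y ∂q
  have hM' : (0 : ℝ) < M := by exact_mod_cast hM
  have hsum_memLp : MemLp (fun x : Fin M → X => ∑ i, (t (x i) - m)) 2 (Measure.pi fun _ => q) :=
    memLp_finsetSum _ fun i _ => (MemLp.sub (.of_bound ht.aestronglyMeasurable R (.of_forall htR))
      (memLp_const m)).comp_measurePreserving (measurePreserving_eval _ i)
  have herror (x : Fin M → X) : sampleMeanError q t x = 1 / M * ‖∑ i, (t (x i) - m)‖ := by
    rw [sampleMeanError, ← Real.norm_of_nonneg (show 0 ≤ 1 / (M : ℝ) by positivity), ← norm_smul,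
      Finset.sum_sub_distrib, smul_sub, Finset.sum_const, Finset.card_univ, Fintype.card_fin,
      ← Nat.cast_smul_eq_nsmul ℝ, smul_smul, Real.norm_of_nonneg (by positivity),
      one_div_mul_cancel hM'.ne', one_smul]
  simp_rw [herror, integral_const_mul]
  calc 1 / (M : ℝ) * ∫ x : Fin M → X, ‖∑ i, (t (x i) - m)‖ ∂(Measure.pi fun _ => q)
      ≤ 1 / (M : ℝ) * √(M * R ^ 2) := by
        gcongr
        refine (integral_le_sqrt_integral_sq hsum_memLp.norm).trans ?_
        exact Real.sqrt_le_sqrt (integral_norm_sum_sub_integral_sq_le q ht htR)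
    _ = R / √M := by
        rw [Real.sqrt_mul hM'.le, Real.sqrt_sq hR]
        field_simp
        rw [Real.sq_sqrt hM'.le]

theorem lintegral_exp_mul_sampleMeanError_le (hR : 0 ≤ R) (hM : 0 < M) {s : ℝ} (hs : 0 ≤ s) :
    ∫⁻ x : Fin M → X, .ofReal (Real.exp (s * sampleMeanError q t x)) ∂(Measure.pi fun _ => q)
      ≤ .ofReal (Real.exp (s * (R / √M) + R ^ 2 / M * s ^ 2 / 2)) := by
  have hsubG := hasSubgaussianMGF_sampleMeanError q ht hR htR (M := M)
  set m := ∫ x : Fin M → X, sampleMeanError q t x ∂(Measure.pi fun _ => q)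
  have hexp (x : Fin M → X) : Real.exp (s * sampleMeanError q t x)
      = Real.exp (s * m) * Real.exp (s * (sampleMeanError q t x - m)) := by
    rw [← Real.exp_add, ← mul_add, add_sub_cancel]
  simp_rw [hexp]
  rw [← ofReal_integral_eq_lintegral_ofReal ((hsubG.integrable_exp_mul s).const_mul _)
    (.of_forall fun x => by positivity), integral_const_mul, Real.exp_add]
  gcongr
  · exact integral_sampleMeanError_le q ht htR hR hM
  · have hmgf := hsubG.mgf_le s
    rwa [Real.coe_toNNReal _ (by positivity)] at hmgf

end SampleMean

section ChainLaw

variable {X : Type*} [MeasurableSpace X]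

theorem chainLaw_succ (T : Kernel X X) (v : ℕ) (q : Measure X) :
    chainLaw T (v + 1) q = (chainLaw T v q).bind T :=
  Function.iterate_succ_apply' _ _ _

instance isProbabilityMeasure_chainLaw (T : Kernel X X) [IsMarkovKernel T] (v : ℕ)
    (q : Measure X) [IsProbabilityMeasure q] : IsProbabilityMeasure (chainLaw T v q) := by
  induction v with
  | zero => simpa only [chainLaw, Function.iterate_zero, id_eq]
  | succ v ih =>
    rw [chainLaw_succ]
    infer_instance

theorem measurable_chainLaw {α : Type*} [MeasurableSpace α] {T : α → Kernel X X}
    [∀ a, IsMarkovKernel (T a)] (hT : Measurable fun p : α × X => T p.1 p.2) (v : ℕ)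
    (q : Measure X) [IsProbabilityMeasure q] : Measurable fun a => chainLaw (T a) v q := by
  induction v with
  | zero => exact measurable_const
  | succ v ih =>
    let κ : Kernel α X := ⟨fun a => chainLaw (T a) v q, ih⟩
    have : IsMarkovKernel κ := ⟨fun a => isProbabilityMeasure_chainLaw (T a) v q⟩
    refine Measure.measurable_of_measurable_coe _ fun s hs => ?_
    simp_rw [chainLaw_succ, Measure.bind_apply hs (Kernel.measurable _).aemeasurable]
    exact Measurable.lintegral_kernel_prod_right' (κ := κ)
      (f := fun p : α × X => T p.1 p.2 s) ((Measure.measurable_coe hs).comp hT)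

end ChainLaw

section SamplesLaw

variable {α X : Type*} [MeasurableSpace α] [MeasurableSpace X]

/-- The kernel that draws, given `a`, a batch of `M` independent samples from `κ a`. -/
def batchKernel (κ : Kernel α X) [IsMarkovKernel κ] (M : ℕ) : Kernel α (Fin M → X) where
  toFun a := Measure.pi fun _ => κ a
  measurable' := by
    refine Measurable.measure_of_isPiSystem_of_isProbabilityMeasure generateFrom_pi.symm
      isPiSystem_pi ?_
    rintro _ ⟨s, hs, rfl⟩
    simp_rw [Measure.pi_pi]
    exact Finset.measurable_prod _ fun i _ => κ.measurable_coe (hs i (Set.mem_univ i))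

theorem batchKernel_apply (κ : Kernel α X) [IsMarkovKernel κ] (M : ℕ) (a : α) :
    batchKernel κ M a = Measure.pi fun _ => κ a :=
  rfl

instance (κ : Kernel α X) [IsMarkovKernel κ] (M : ℕ) : IsMarkovKernel (batchKernel κ M) :=
  ⟨fun a => by rw [batchKernel_apply]; infer_instance⟩

theorem measurable_snoc {k : ℕ} :
    Measurable fun p : (Fin k → X) × X => Fin.snoc (α := fun _ => X) p.1 p.2 := by
  refine measurable_pi_iff.2 fun i => ?_
  induction i using Fin.lastCases with
  | last => simpa only [Fin.snoc_last] using measurable_snd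
  | cast j =>
    simp only [Fin.snoc_castSucc]
    exact (measurable_pi_apply j).comp measurable_fst

theorem measurable_snoc_right {k : ℕ} (h : Fin k → X) :
    Measurable fun x => Fin.snoc (α := fun _ => X) h x :=
  measurable_snoc.comp measurable_prodMk_left

theorem measurable_map_snoc {k : ℕ} (κ : Kernel (Fin k → X) X) [IsSFiniteKernel κ] :
    Measurable fun h => (κ h).map fun x => Fin.snoc (α := fun _ => X) h x := by
  refine Measure.measurable_of_measurable_coe _ fun s hs => ?_
  simp_rw [Measure.map_apply (measurable_snoc_right _) hs]
  exact Kernel.measurable_kernel_prodMk_left (κ := κ) (measurable_snoc hs)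

variable {n K M : ℕ} {step : Param n → (Fin M → X) → Param n} {θ₀ : Param n}

theorem measurable_iter (hstep : Measurable (Function.uncurry step)) (k : ℕ) :
    Measurable fun h : Fin K → Fin M → X => iter step θ₀ h k := by
  induction k with
  | zero => exact measurable_const
  | succ k ih =>
    by_cases hk : k < K
    · simp only [iter, hk, dite_true]
      exact hstep.comp (ih.prodMk (measurable_pi_apply _))
    · simpa only [iter, hk, dite_false] using ih

theorem measurable_comp_iter {β : Type*} [MeasurableSpace β]
    (hstep : Measurable (Function.uncurry step)) {W : Param n → (Fin M → X) → β}
    (hW : Measurable (Function.uncurry W)) (j : Fin K) :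
    Measurable fun h : Fin K → Fin M → X => W (iter step θ₀ h j) (h j) :=
  hW.comp ((measurable_iter hstep j).prodMk (measurable_pi_apply j))

omit [MeasurableSpace X] in
theorem iter_snoc {k : ℕ} (h : Fin k → Fin M → X) (x : Fin M → X) {j : ℕ} (hj : j ≤ k) :
    iter step θ₀ (Fin.snoc (α := fun _ => Fin M → X) h x) j = iter step θ₀ h j := by
  induction j with
  | zero => rfl
  | succ j ih =>
    have hbatch := Fin.snoc_castSucc (α := fun _ => Fin M → X) x h ⟨j, hj⟩
    simp only [Fin.castSucc_mk] at hbatch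
    simp only [iter, Nat.lt_succ_of_lt hj, Nat.lt_of_succ_le hj, dite_true, hbatch,
      ih (Nat.le_of_succ_le hj)]

variable (hstep : Measurable (Function.uncurry step)) (Q : Kernel (Param n) X) [IsMarkovKernel Q]

include hstep

theorem measurable_nextBatchLaw (k : ℕ) :
    Measurable fun h : Fin k → Fin M → X =>
      (Measure.pi fun _ : Fin M => Q (iter step θ₀ h k)).map
        fun x => Fin.snoc (α := fun _ => Fin M → X) h x :=
  measurable_map_snoc ((batchKernel Q M).comap _ (measurable_iter hstep k))

theorem isProbabilityMeasure_samplesLaw (k : ℕ) :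
    IsProbabilityMeasure (samplesLaw step θ₀ Q k) := by
  induction k with
  | zero => rw [samplesLaw]; infer_instance
  | succ k ih =>
    exact isProbabilityMeasure_bind (measurable_nextBatchLaw hstep Q k).aemeasurable <|
      .of_forall fun h => Measure.isProbabilityMeasure_map
        (measurable_snoc_right h).aemeasurable

theorem lintegral_samplesLaw_succ (k : ℕ) {F : (Fin (k + 1) → Fin M → X) → ℝ≥0∞}
    (hF : Measurable F) :
    ∫⁻ h, F h ∂(samplesLaw step θ₀ Q (k + 1))
      = ∫⁻ h, ∫⁻ x, F (Fin.snoc (α := fun _ => Fin M → X) h x)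
          ∂(Measure.pi fun _ : Fin M => Q (iter step θ₀ h k)) ∂(samplesLaw step θ₀ Q k) := by
  rw [samplesLaw, Measure.lintegral_bind (measurable_nextBatchLaw hstep Q k).aemeasurable
    hF.aemeasurable]
  exact lintegral_congr fun h => lintegral_map hF (measurable_snoc_right h)

variable {W : Param n → (Fin M → X) → ℝ≥0∞} (hW : Measurable (Function.uncurry W))

include hW

omit [IsMarkovKernel Q] in
theorem measurable_prod_iter (k : ℕ) :
    Measurable fun h : Fin k → Fin M → X => ∏ j : Fin k, W (iter step θ₀ h j) (h j) :=
  Finset.measurable_prod _ fun j _ => measurable_comp_iter hstep hW j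

theorem lintegral_prod_iter_samplesLaw_le {B : ℝ≥0∞}
    (hB : ∀ θ, ∫⁻ x, W θ x ∂(Measure.pi fun _ : Fin M => Q θ) ≤ B) (k : ℕ) :
    ∫⁻ h, ∏ j : Fin k, W (iter step θ₀ h j) (h j) ∂(samplesLaw step θ₀ Q k) ≤ B ^ k := by
  induction k with
  | zero =>
    have := isProbabilityMeasure_samplesLaw (θ₀ := θ₀) hstep Q 0
    simp
  | succ k ih =>
    have hsnoc (h : Fin k → Fin M → X) (x : Fin M → X) :
        ∏ j : Fin (k + 1), W (iter step θ₀ (Fin.snoc (α := fun _ => Fin M → X) h x) j)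
            (Fin.snoc (α := fun _ => Fin M → X) h x j)
          = (∏ j : Fin k, W (iter step θ₀ h j) (h j)) * W (iter step θ₀ h k) x := by
      simp only [Fin.prod_univ_castSucc, Fin.snoc_castSucc, Fin.val_castSucc, Fin.snoc_last,
        Fin.val_last, iter_snoc h x le_rfl, iter_snoc h x (Fin.is_lt _).le]
    calc ∫⁻ h, ∏ j : Fin (k + 1), W (iter step θ₀ h j) (h j) ∂(samplesLaw step θ₀ Q (k + 1))
        = ∫⁻ h, (∏ j : Fin k, W (iter step θ₀ h j) (h j))
            * ∫⁻ x, W (iter step θ₀ h k) x ∂(Measure.pi fun _ => Q (iter step θ₀ h k))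
            ∂(samplesLaw step θ₀ Q k) := by
          rw [lintegral_samplesLaw_succ hstep Q k (measurable_prod_iter hstep hW (k + 1))]
          simp_rw [hsnoc]
          exact lintegral_congr fun h => lintegral_const_mul _ (hW.comp measurable_prodMk_left)
      _ ≤ ∫⁻ h, (∏ j : Fin k, W (iter step θ₀ h j) (h j)) * B ∂(samplesLaw step θ₀ Q k) := by
          gcongr with h
          exact hB _
      _ ≤ B ^ (k + 1) := by
          rw [lintegral_mul_const _ (measurable_prod_iter hstep hW k), pow_succ]
          gcongr

end SamplesLaw

section SamplingError

theorem one_sub_le_measureReal_of_lintegral_exp_le {Ω : Type*} [MeasurableSpace Ω]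
    {μ : Measure Ω} [IsProbabilityMeasure μ] {S : Ω → ℝ} (hS : Measurable S) {c δ : ℝ}
    (hδ : 0 ≤ δ) (hexp : ∫⁻ ω, .ofReal (Real.exp (S ω)) ∂μ ≤ .ofReal (δ * Real.exp c)) :
    1 - δ ≤ μ.real {ω | S ω ≤ c} := by
  have hexpS : Measurable fun ω => ENNReal.ofReal (Real.exp (S ω)) := hS.exp.ennreal_ofReal
  have hmarkov : ENNReal.ofReal (Real.exp c) * μ {ω | c < S ω} ≤ .ofReal (δ * Real.exp c) :=
    calc ENNReal.ofReal (Real.exp c) * μ {ω | c < S ω}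
        ≤ .ofReal (Real.exp c)
            * μ {ω | ENNReal.ofReal (Real.exp c) ≤ .ofReal (Real.exp (S ω))} := by
          gcongr
          exact fun hω => ENNReal.ofReal_le_ofReal (Real.exp_le_exp.2 hω.le)
      _ ≤ _ := (mul_meas_ge_le_lintegral hexpS _).trans hexp
  have htail : μ.real {ω | c < S ω} ≤ δ := by
    have h := ENNReal.toReal_mono ENNReal.ofReal_ne_top hmarkov
    rw [ENNReal.toReal_mul, ENNReal.toReal_ofReal (by positivity),
      ENNReal.toReal_ofReal (by positivity), mul_comm] at h
    exact le_of_mul_le_mul_right h (Real.exp_pos c)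
  have hcompl : {ω | S ω ≤ c} = {ω | c < S ω}ᶜ := by
    ext ω
    simp
  rw [hcompl, probReal_compl_eq_one_sub (measurableSet_lt measurable_const hS)]
  linarith

theorem measurable_sampleMeanError_kernel {α X E : Type*} [MeasurableSpace α] [MeasurableSpace X]
    [NormedAddCommGroup E] [InnerProductSpace ℝ E] (κ : Kernel α X) [IsSFiniteKernel κ]
    {t : X → E} (ht : StronglyMeasurable t) (M : ℕ) :
    Measurable fun p : α × (Fin M → X) => sampleMeanError (κ p.1) t p.2 := by
  have hsum : StronglyMeasurable fun p : α × (Fin M → X) => ∑ i, t (p.2 i) :=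
    Finset.stronglyMeasurable_fun_sum _ fun i _ =>
      ht.comp_measurable ((measurable_pi_apply i).comp measurable_snd)
  have hmean : StronglyMeasurable fun p : α × (Fin M → X) => ∫ y, t y ∂κ p.1 :=
    (ht.integral_kernel (κ := κ)).comp_measurable measurable_fst
  exact ((hsum.const_smul (1 / (M : ℝ))).sub hmean).norm.measurable

variable {n : ℕ} {X : Type*} [MeasurableSpace X] {M : ℕ}
  {step : Param n → (Fin M → X) → Param n} (hstep : Measurable (Function.uncurry step))
  (θ₀ : Param n) (Q : Kernel (Param n) X) [IsMarkovKernel Q] {t : X → Param n}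
  (ht : StronglyMeasurable t) {R : ℝ} (htR : ∀ x, ‖t x‖ ≤ R) (hM : 0 < M)

include hstep ht htR hM

theorem lintegral_exp_sum_sampleMeanError_le (hR : 0 ≤ R) {s : ℝ} (hs : 0 ≤ s) (K : ℕ) :
    ∫⁻ h, .ofReal (Real.exp (s * ∑ j : Fin K, sampleMeanError (Q (iter step θ₀ h j)) t (h j)))
        ∂(samplesLaw step θ₀ Q K)
      ≤ .ofReal (Real.exp (K * (s * (R / √M) + R ^ 2 / M * s ^ 2 / 2))) := by
  have hprod := lintegral_prod_iter_samplesLaw_le (θ₀ := θ₀) hstep Q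
    (W := fun θ x => ENNReal.ofReal (Real.exp (s * sampleMeanError (Q θ) t x)))
    ((measurable_sampleMeanError_kernel Q ht M).const_mul s).exp.ennreal_ofReal
    (fun θ => lintegral_exp_mul_sampleMeanError_le (Q θ) ht htR hR hM hs) K
  rw [← ENNReal.ofReal_pow (Real.exp_pos _).le, ← Real.exp_nat_mul] at hprod
  refine le_of_eq_of_le (lintegral_congr fun h => ?_) hprod
  rw [Finset.mul_sum, Real.exp_sum, ENNReal.ofReal_prod_of_nonneg fun _ _ => (Real.exp_pos _).le]

theorem one_sub_le_measureReal_sum_sampleMeanError_le (hR : 0 < R) {δ : ℝ} (hδ : 0 < δ) (K : ℕ) :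
    1 - δ ≤ (samplesLaw step θ₀ Q K).real
      {h | ∑ j : Fin K, sampleMeanError (Q (iter step θ₀ h j)) t (h j)
        ≤ R * (K / √M + K / (2 * M) + Real.log (1 / δ))} := by
  have := isProbabilityMeasure_samplesLaw (θ₀ := θ₀) hstep Q K
  have herror : Measurable fun h : Fin K → Fin M → X =>
      ∑ j : Fin K, sampleMeanError (Q (iter step θ₀ h j)) t (h j) :=
    Finset.measurable_fun_sum _ fun j _ =>
      measurable_comp_iter hstep (W := fun θ => sampleMeanError (Q θ) t)
        (measurable_sampleMeanError_kernel Q ht M) j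
  have hmgf := lintegral_exp_sum_sampleMeanError_le hstep θ₀ Q ht htR hM hR.le
    (inv_nonneg.2 hR.le) K
  have hexponent : Real.exp (K * (R⁻¹ * (R / √M) + R ^ 2 / M * R⁻¹ ^ 2 / 2))
      = δ * Real.exp (K / √M + K / (2 * M) + Real.log (1 / δ)) := by
    rw [Real.exp_add, Real.exp_log (by positivity), mul_left_comm, mul_one_div_cancel hδ.ne',
      mul_one]
    congr 1
    field_simp
  rw [hexponent] at hmgf
  simpa only [inv_mul_le_iff₀ hR] using
    one_sub_le_measureReal_of_lintegral_exp_le (herror.const_mul R⁻¹) hδ.le hmgf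

end SamplingError

section StochasticProjectedGradient

variable {n : ℕ} {X : Type*} {Θ : Set (Param n)} {θ₀ : Param n} {K M : ℕ}

theorem iter_succ_of_lt (step : Param n → (Fin M → X) → Param n) (h : Fin K → Fin M → X)
    {k : ℕ} (hk : k < K) : iter step θ₀ h (k + 1) = step (iter step θ₀ h k) (h ⟨k, hk⟩) :=
  dif_pos hk

theorem iter_mem {step : Param n → (Fin M → X) → Param n} (hstep : ∀ θ x, step θ x ∈ Θ)
    (hθ₀ : θ₀ ∈ Θ) (h : Fin K → Fin M → X) (k : ℕ) : iter step θ₀ h k ∈ Θ := by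
  induction k with
  | zero => exact hθ₀
  | succ k ih =>
    rw [iter]
    split_ifs
    · exact hstep _ _
    · exact ih

variable [MeasurableSpace X]

theorem measurable_pgdStep (hne : Θ.Nonempty) (hconv : Convex ℝ Θ) (hclosed : IsClosed Θ)
    {t : X → Param n} (ht : Measurable t) (tbar : Param n) (lam L : ℝ) (M : ℕ) :
    Measurable (Function.uncurry (pgdStep t tbar lam L Θ (M := M))) := by
  refine (lipschitzWith_proj hne hconv hclosed).continuous.measurable.comp ?_
  have : Measurable fun p : Param n × (Fin M → X) => ∑ i, t (p.2 i) :=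
    Finset.measurable_fun_sum _ fun i _ =>
      ht.comp ((measurable_pi_apply i).comp measurable_snd)
  fun_prop

theorem pgdStep_eq_proj_gradLik_add (ν : Measure X) (t : X → Param n) (lam L : ℝ) {D : ℕ}
    (z : Fin D → X) (θ : Param n) (x : Fin M → X) :
    pgdStep t (empMean t z) lam L Θ θ x = proj Θ (θ - (1 / L) • (gradLik ν t lam z θ
      + ((1 / (M : ℝ)) • ∑ i, t (x i) - meanStat ν t θ))) := by
  rw [pgdStep, gradLik]
  congr 3
  abel

variable {ν : Measure X} [IsFiniteMeasure ν] [NeZero ν] {t : X → Param n} (ht : Measurable t)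
  {R : ℝ} (htR : ∀ x, ‖t x‖ ≤ R)

include ht htR

theorem norm_sampleMean_sub_meanStat_le (q : Measure X) [IsProbabilityMeasure q] (θ : Param n)
    (x : Fin M → X) :
    ‖(1 / (M : ℝ)) • ∑ i, t (x i) - meanStat ν t θ‖
      ≤ sampleMeanError q t x + 2 * R * tvDist q (expFamily ν t θ) := by
  have := isProbabilityMeasure_expFamily (ν := ν) ht htR θ
  exact (norm_sub_le_norm_sub_add_norm_sub _ (∫ y, t y ∂q) _).trans
    (add_le_add_right (norm_integral_sub_le_tvDist q _ ht.stronglyMeasurable htR) _)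

variable {lam : ℝ} (hlam : 0 ≤ lam) {D : ℕ} (hD : 0 < D) (z : Fin D → X) (hconv : Convex ℝ Θ)
  (hclosed : IsClosed Θ) (hθ₀ : θ₀ ∈ Θ) {θstar : Param n} (hstar : θstar ∈ Θ)
  (hmin : ∀ θ ∈ Θ, negLogLik ν t lam z θstar ≤ negLogLik ν t lam z θ) (hK : 0 < K) {L : ℝ}
  (hL : 0 < L) (hf : HasLipschitzGradient (negLogLik ν t lam z) L) (h : Fin K → Fin M → X)

include hlam hD hconv hclosed hθ₀ hstar hmin hK hL hf

theorem negLogLik_average_sub_le_sum_norm :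
    negLogLik ν t lam z ((1 / (K : ℝ)) •
        ∑ k ∈ Finset.Icc 1 K, iter (pgdStep t (empMean t z) lam L Θ) θ₀ h k)
      - negLogLik ν t lam z θstar
      ≤ L / (2 * K) * (‖θ₀ - θstar‖ + 2 / L * ∑ j : Fin K, ‖(1 / (M : ℝ)) • ∑ i, t (h j i)
        - meanStat ν t (iter (pgdStep t (empMean t z) lam L Θ) θ₀ h j)‖) ^ 2 := by
  set θ : ℕ → Param n := iter (pgdStep t (empMean t z) lam L Θ) θ₀ h
  have hzero : θ 0 = θ₀ := rfl
  have hne : Θ.Nonempty := ⟨θstar, hstar⟩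
  have hmem (k : ℕ) : θ k ∈ Θ := iter_mem (fun _ _ => proj_mem hne hconv hclosed _) hθ₀ h k
  have hgrad := hasGradientAt_negLogLik (ν := ν) ht htR hlam hD z
  have hlip (φ ψ : Param n) :
      ‖gradLik ν t lam z φ - gradLik ν t lam z ψ‖ ≤ L * ‖φ - ψ‖ := by
    simpa only [gradient_negLogLik ht htR hlam hD z] using hf.2 φ ψ
  let e (k : ℕ) : Param n :=
    if hk : k < K then (1 / (M : ℝ)) • ∑ i, t (h ⟨k, hk⟩ i) - meanStat ν t (θ k) else 0
  have hstep : ∀ k < K, ⟪θ k - (1 / L) • (gradLik ν t lam z (θ k) + e k) - θ (k + 1),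
      θstar - θ (k + 1)⟫ ≤ 0 := by
    intro k hk
    have hsucc : θ (k + 1) = proj Θ (θ k - (1 / L) • (gradLik ν t lam z (θ k) + e k)) := by
      simp only [e, hk, dite_true]
      exact (iter_succ_of_lt _ h hk).trans (pgdStep_eq_proj_gradLik_add ν t lam L z _ _)
    rw [hsucc]
    exact inner_sub_proj_nonpos hne hconv hclosed _ hstar
  have hpgd := projected_gradient_average_sub_le hL (negLogLik_add_inner_le ht htR hlam hD z)
    (le_quadratic_of_lipschitz_gradient hgrad hlip) hK hstep fun k _ => hmin _ (hmem _)
  simpa only [hzero, Finset.sum_range, e, Fin.is_lt, dite_true, Fin.eta] using hpgd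

theorem negLogLik_average_sub_le (hR : 0 < R) {Q : Param n → Measure X}
    [∀ θ, IsProbabilityMeasure (Q θ)] {ε b : ℝ}
    (hQ : ∀ θ ∈ Θ, tvDist (Q θ) (expFamily ν t θ) ≤ ε)
    (hb : ∑ j : Fin K, sampleMeanError
      (Q (iter (pgdStep t (empMean t z) lam L Θ) θ₀ h j)) t (h j) ≤ 2 * R * b) :
    negLogLik ν t lam z ((1 / (K : ℝ)) •
        ∑ k ∈ Finset.Icc 1 K, iter (pgdStep t (empMean t z) lam L Θ) θ₀ h k)
      - negLogLik ν t lam z θstar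
      ≤ 8 * R ^ 2 / (K * L) * (L * ‖θ₀ - θstar‖ / (4 * R) + b + K * ε) ^ 2 := by
  have : (0 : ℝ) < K := by exact_mod_cast hK
  refine (negLogLik_average_sub_le_sum_norm ht htR hlam hD z hconv hclosed hθ₀ hstar hmin hK hL hf
    h).trans ?_
  set θ : ℕ → Param n := iter (pgdStep t (empMean t z) lam L Θ) θ₀ h
  have hmem (k : ℕ) : θ k ∈ Θ :=
    iter_mem (fun _ _ => proj_mem ⟨θstar, hstar⟩ hconv hclosed _) hθ₀ h k
  have herr : ∑ j : Fin K, ‖(1 / (M : ℝ)) • ∑ i, t (h j i) - meanStat ν t (θ j)‖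
      ≤ 2 * R * (b + K * ε) :=
    calc _ ≤ ∑ j : Fin K, (sampleMeanError (Q (θ j)) t (h j) + 2 * R * ε) := by
          gcongr with j
          refine (norm_sampleMean_sub_meanStat_le ht htR (Q (θ j)) _ _).trans ?_
          gcongr
          exact hQ _ (hmem j)
      _ ≤ 2 * R * (b + K * ε) := by
          rw [Finset.sum_add_distrib, Finset.sum_const, Finset.card_univ, Fintype.card_fin,
            nsmul_eq_mul]
          linarith
  calc _ ≤ L / (2 * K) * (‖θ₀ - θstar‖ + 2 / L * (2 * R * (b + K * ε))) ^ 2 := by gcongr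
    _ = _ := by
        field_simp
        ring

end StochasticProjectedGradient

end MCMCLearning

end

open MCMCLearning in
theorem theorem2_general {n : ℕ} {X : Type*} [MeasurableSpace X]
    (ν : Measure X) [IsFiniteMeasure ν] [NeZero ν]
    (t : X → Param n) (ht : Measurable t) (R₂ : ℝ) (hR₂ : 0 < R₂) (htR : ∀ x, ‖t x‖ ≤ R₂)
    {D : ℕ} (hD : 0 < D) (z : Fin D → X) (lam : ℝ) (hlam : 0 ≤ lam)
    (Θ : Set (Param n)) (hΘconv : Convex ℝ Θ) (hΘclosed : IsClosed Θ)
    (θstar : Param n) (hstar : θstar ∈ Θ)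
    (hmin : ∀ θ ∈ Θ, negLogLik ν t lam z θstar ≤ negLogLik ν t lam z θ)
    (θ₀ : Param n) (hθ₀ : θ₀ ∈ Θ)
    (Q : Kernel (Param n) X) [IsMarkovKernel Q]
    (ε : ℝ) (hQ : ∀ θ ∈ Θ, tvDist (Q θ) (expFamily ν t θ) ≤ ε)
    (K M : ℕ) (hK : 0 < K) (hM : 0 < M) (δ : ℝ) (hδ0 : 0 < δ) (hδ1 : δ < 1) :
    HasLipschitzGradient (negLogLik ν t lam z) (4 * R₂ ^ 2 + lam) ∧
    ∀ L : ℝ, 0 < L → HasLipschitzGradient (negLogLik ν t lam z) L →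
      1 - δ ≤ (samplesLaw (pgdStep t (empMean t z) lam L Θ (M := M)) θ₀ Q K).real
        {h | negLogLik ν t lam z ((1 / (K : ℝ)) •
              ∑ k ∈ Finset.Icc 1 K, iter (pgdStep t (empMean t z) lam L Θ) θ₀ h k)
            - negLogLik ν t lam z θstar
          ≤ 8 * R₂ ^ 2 / (K * L) *
            (L * ‖θ₀ - θstar‖ / (4 * R₂) + Real.log (1 / δ) + K / √M + K * ε) ^ 2} := by
  refine ⟨hasLipschitzGradient_negLogLik ht htR hlam hD z, fun L hL hf => ?_⟩
  have hstep := measurable_pgdStep ⟨θstar, hstar⟩ hΘconv hΘclosed ht (empMean t z) lam L M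
  have := isProbabilityMeasure_samplesLaw (θ₀ := θ₀) hstep Q K
  have hlog : 0 ≤ Real.log (1 / δ) := Real.log_nonneg (one_le_one_div hδ0 hδ1.le)
  have hrate : (K : ℝ) / (2 * M) ≤ K / √M := by
    have hM' : (1 : ℝ) ≤ M := by exact_mod_cast hM
    have hsqrt : √(M : ℝ) ≤ M := Real.sqrt_le_self_iff.2 (.inr hM')
    gcongr
    linarith
  refine (one_sub_le_measureReal_sum_sampleMeanError_le hstep θ₀ Q ht.stronglyMeasurable htR hM hR₂
    hδ0 K).trans (measureReal_mono fun h hsum => ?_)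
  rw [Set.mem_ofPred_eq, add_assoc (L * ‖θ₀ - θstar‖ / (4 * R₂))]
  refine negLogLik_average_sub_le ht htR hlam hD z hΘconv hΘclosed hθ₀ hstar hmin hK hL hf h hR₂
    hQ (hsum.trans ?_)
  rw [mul_comm 2 R₂, mul_assoc]
  gcongr
  linarith

theorem theorem2 {n : ℕ} {X : Type*} [MeasurableSpace X]
    -- exponential family with bounded sufficient statistics; as `t` is bounded, normalizability
    -- means that the reference measure is finite and nonzero
    (ν : Measure X) [IsFiniteMeasure ν] (hν : ν ≠ 0)
    (t : X → MCMCLearning.Param n) (ht : Measurable t)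
    (R₂ : ℝ) (hR₂ : 0 < R₂) (htR : ∀ x, ‖t x‖ ≤ R₂)
    -- data and regularization
    {D : ℕ} (hD : 0 < D) (z : Fin D → X) (lam : ℝ) (hlam : 0 ≤ lam)
    -- constraint set, minimizer, initial point
    (Θ : Set (MCMCLearning.Param n)) (hΘconv : Convex ℝ Θ) (hΘclosed : IsClosed Θ)
    (θstar : MCMCLearning.Param n) (hstar : θstar ∈ Θ)
    (hmin : ∀ θ ∈ Θ, MCMCLearning.negLogLik ν t lam z θstar ≤ MCMCLearning.negLogLik ν t lam z θ)
    (θ₀ : MCMCLearning.Param n) (hθ₀ : θ₀ ∈ Θ)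
    -- Markov chains, mixing geometrically on `Θ`
    (T : MCMCLearning.Param n → Kernel X X) (hT : ∀ θ, IsMarkovKernel (T θ))
    (hTmeas : Measurable fun p : MCMCLearning.Param n × X => T p.1 p.2)
    (C α : ℝ) (hmix : MCMCLearning.FastMixing ν t T Θ C α)
    -- starting distribution, number of chain steps, of iterations and of samples
    (r : Measure X) [IsProbabilityMeasure r]
    (v K M : ℕ) (hK : 0 < K) (δ : ℝ) (hδ0 : 0 < δ) (hδ1 : δ < 1)
    (hM : 3 * (K : ℝ) / Real.log (1 / δ) ≤ M) :
    MCMCLearning.HasLipschitzGradient (MCMCLearning.negLogLik ν t lam z) (4 * R₂ ^ 2 + lam) ∧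
    ∀ L : ℝ, 0 < L → MCMCLearning.HasLipschitzGradient (MCMCLearning.negLogLik ν t lam z) L →
      1 - δ ≤
        (MCMCLearning.samplesLaw
          (MCMCLearning.pgdStep t (MCMCLearning.empMean t z) lam L Θ (M := M)) θ₀
          (fun θ => MCMCLearning.chainLaw (T θ) v r) K).real
        {h | MCMCLearning.negLogLik ν t lam z
              ((1 / (K : ℝ)) • ∑ k ∈ Finset.Icc 1 K, MCMCLearning.iter
                (MCMCLearning.pgdStep t (MCMCLearning.empMean t z) lam L Θ) θ₀ h k)
            - MCMCLearning.negLogLik ν t lam z θstar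
          ≤ 8 * R₂ ^ 2 / (K * L) *
            (L * ‖θ₀ - θstar‖ / (4 * R₂) + Real.log (1 / δ) + K / Real.sqrt M
              + K * C * α ^ v) ^ 2} := by
  have : NeZero ν := ⟨hν⟩
  have hM0 : (0 : ℝ) < M := hM.trans_lt' (by
    have := Real.log_pos (one_lt_one_div hδ0 hδ1)
    positivity)
  let Q : Kernel (MCMCLearning.Param n) X :=
    ⟨fun θ => MCMCLearning.chainLaw (T θ) v r, MCMCLearning.measurable_chainLaw hTmeas v r⟩
  have : IsMarkovKernel Q := ⟨fun θ => MCMCLearning.isProbabilityMeasure_chainLaw (T θ) v r⟩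
  simp_rw [mul_assoc (K : ℝ) C]
  exact theorem2_general ν t ht R₂ hR₂ htR hD z lam hlam Θ hΘconv hΘclosed
    θstar hstar hmin θ₀ hθ₀ Q (C * α ^ v) (fun θ hθ => hmix θ hθ r inferInstance v) K M hK
    (by exact_mod_cast hM0) δ hδ0 hδ1
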